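/- There is a sequence $(a_n)_{n\ge 1}$ of non-negative integers such that $a_n=\Theta(n^{1/2})$ as $n\to\infty$ and the associated Rademacher walk is weakly recurrent; here, for i.i.d. random variables $\epsilon_1,\epsilon_2,\dots$ taking each of the values $+1$ and $-1$ with probability $1/2$, the walk is $X_n=\sum_{k=1}^n\epsilon_k a_k$ ($n\ge 0$), and it is called weakly recurrent if almost surely there is a (random) $C<\infty$ such that $|X_n|\le C$ for infinitely many $n$. Explicitly, the sequence may be taken to consist of consecutive blocks numbered $k=1,2,3,\dots$, where the $k$-th block has length $4^k/2$ and its terms alternate between $2^k+1$ and $2^k-1$, starting with $2^k+1$; that is, with $n_k=1+\sum_{i=1}^{k-1}4^i/2$, for all $k\ge 1$ and $0\le j<4^k/2$, $$a_{n_k+j}=\begin{cases}2^k+1 & \text{if } j \text{ is even},\\ 2^k-1 & \text{if } j\text{ is odd},\end{cases}$$ and for this sequence, almost surely, for every even integer $m$ there are infinitely many $n$ with $X_n=m$. -/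

import Mathlib

open MeasureTheory ProbabilityTheory Filter Asymptotics

/-- `ε 1, ε 2, …` are i.i.d. Rademacher random variables on the probability space `(Ω, μ)`:
each takes the values `1` and `-1` with probability `1/2`. Sequences are indexed from `1`;
nothing is required of `ε 0`. -/
structure IsRademacherSequence {Ω : Type*} [MeasurableSpace Ω] (μ : Measure Ω)
    (ε : ℕ → Ω → ℝ) : Prop where
  measurable : ∀ k, 1 ≤ k → Measurable (ε k)
  prob_eq_one : ∀ k, 1 ≤ k → μ {ω | ε k ω = 1} = 1 / 2
  prob_eq_neg_one : ∀ k, 1 ≤ k → μ {ω | ε k ω = -1} = 1 / 2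
  indep : iIndepFun (fun k : ℕ => ε (k + 1)) μ

/-- The walk `X_n = ∑_{k = 1}^n ε_k a_k` with step sizes `a_1, a_2, …` and signs `ε`. -/
def rademacherWalk {Ω : Type*} (a : ℕ → ℝ) (ε : ℕ → Ω → ℝ) (n : ℕ) (ω : Ω) : ℝ :=
  ∑ k ∈ Finset.Icc 1 n, ε k ω * a k

/-- Almost surely there is a (random) `C` such that `|X_n| ≤ C` for infinitely many `n`. -/
def WeaklyRecurrent {Ω : Type*} [MeasurableSpace Ω] (μ : Measure Ω) (X : ℕ → Ω → ℝ) : Prop :=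
  ∀ᵐ ω ∂μ, ∃ C : ℝ, ∃ᶠ n in atTop, |X n ω| ≤ C

/-- The index `n_k = 1 + ∑_{i = 1}^{k - 1} 4^i / 2` at which the `k`-th block begins, `k ≥ 1`
(each `4^i / 2` is an integer). -/
def blockStart (k : ℕ) : ℕ := 1 + ∑ i ∈ Finset.Ico 1 k, 4 ^ i / 2

/-! In the `k`-th block, after an even number of steps, the displacement is `(w + 1) S + (w - 1)
S'`, where `w = 2 ^ k` and `S`, `S'` are independent simple random walks. So `(S, S')` is a planar
walk, and hitting a given even integer only requires hitting one suitable lattice point.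

By Chebyshev the walk is within `C * 4 ^ k` of the origin when the block starts, except with
probability `1 / C ^ 2`. Since `w` is even, `exists_repr` then supplies a target point at distance
`O(2 ^ k)`. The block lasts of order `4 ^ k` steps, the diffusive time for that distance, so a
planar walk hits the target with probability at least `c / k`: the expected number of hits is
bounded below, while the expected number of returns after a hit is `O(k)`
(`exp_div_le_measureReal_biUnion_pairEvent`).

This holds conditionally on the past (`exists_div_le_measureReal_inter_visit`). As `∑ 1 / k`
diverges, avoiding the integer forever has probability at most `1 / C ^ 2` for every `C`, hence zero
(`measureReal_avoid_eq_zero`). -/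

/-! ### Independence and the binomial law of sums of signs. -/

section Signs

variable {Ω : Type*}

/-- The sum of the signs with (zero-based) indices in `J`. -/
def signSum (ε : ℕ → Ω → ℝ) (J : Finset ℕ) (ω : Ω) : ℝ := ∑ i ∈ J, ε (i + 1) ω

/-- The σ-algebra generated by the signs with (zero-based) indices in `S`. -/
@[reducible] def signSigma (ε : ℕ → Ω → ℝ) (S : Set ℕ) : MeasurableSpace Ω :=
  ⨆ i ∈ S, MeasurableSpace.comap (ε (i + 1)) inferInstance

lemma signSigma_mono (ε : ℕ → Ω → ℝ) {S T : Set ℕ} (h : S ⊆ T) :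
    signSigma ε S ≤ signSigma ε T :=
  biSup_mono h

lemma measurable_sign (ε : ℕ → Ω → ℝ) {S : Set ℕ} {i : ℕ} (hi : i ∈ S) :
    Measurable[signSigma ε S] (ε (i + 1)) :=
  Measurable.of_comap_le
    (le_iSup₂ (f := fun i _ => MeasurableSpace.comap (ε (i + 1)) inferInstance) i hi)

lemma measurable_signSum (ε : ℕ → Ω → ℝ) {S : Set ℕ} {J : Finset ℕ} (hJ : ∀ i ∈ J, i ∈ S) :
    Measurable[signSigma ε S] (signSum ε J) := by
  unfold signSum
  exact Finset.measurable_fun_sum J fun i hi => measurable_sign ε (hJ i hi)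

lemma measurableSet_signSum_eq (ε : ℕ → Ω → ℝ) {S : Set ℕ} {J : Finset ℕ}
    (hJ : ∀ i ∈ J, i ∈ S) (v : ℝ) : MeasurableSet[signSigma ε S] {ω | signSum ε J ω = v} :=
  measurable_signSum ε hJ (measurableSet_singleton v)

variable [MeasurableSpace Ω] {μ : Measure Ω} {ε : ℕ → Ω → ℝ}

namespace IsRademacherSequence

lemma signSigma_le (h : IsRademacherSequence μ ε) (S : Set ℕ) :
    signSigma ε S ≤ ‹MeasurableSpace Ω› :=
  iSup₂_le fun i _ => (h.measurable (i + 1) (by omega)).comap_le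

lemma measureReal_inter (h : IsRademacherSequence μ ε) {S T : Set ℕ} (hST : Disjoint S T)
    {E F : Set Ω} (hE : MeasurableSet[signSigma ε S] E) (hF : MeasurableSet[signSigma ε T] F) :
    μ.real (E ∩ F) = μ.real E * μ.real F := by
  have hi : Indep (signSigma ε S) (signSigma ε T) μ :=
    indep_iSup_of_disjoint (fun i => (h.measurable (i + 1) (by omega)).comap_le) h.indep hST
  rw [Measure.real, (Indep_iff _ _ _).1 hi E F hE hF, ENNReal.toReal_mul]
  rfl

lemma ae_eq_one_or [IsProbabilityMeasure μ] (h : IsRademacherSequence μ ε) :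
    ∀ᵐ ω ∂μ, ∀ i, ε (i + 1) ω = 1 ∨ ε (i + 1) ω = -1 := by
  rw [ae_all_iff]
  intro i
  have hm := h.measurable (i + 1) (by omega)
  have hd : Disjoint {ω | ε (i + 1) ω = 1} {ω | ε (i + 1) ω = -1} := by
    rw [Set.disjoint_left]
    intro ω h1 h2
    simp only [Set.mem_ofPred_eq] at h1 h2
    linarith
  have hm1 : MeasurableSet {ω | ε (i + 1) ω = 1} := hm (measurableSet_singleton 1)
  have hm2 : MeasurableSet {ω | ε (i + 1) ω = -1} := hm (measurableSet_singleton (-1))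
  have hu : μ ({ω | ε (i + 1) ω = 1} ∪ {ω | ε (i + 1) ω = -1}) = 1 := by
    rw [measure_union hd hm2, h.prob_eq_one _ (by omega), h.prob_eq_neg_one _ (by omega),
      ENNReal.add_halves]
  exact (mem_ae_iff_prob_eq_one (hm1.union hm2)).2 hu

lemma measureReal_insert [IsProbabilityMeasure μ] (h : IsRademacherSequence μ ε)
    {i : ℕ} {J : Finset ℕ} (hi : i ∉ J) (v : ℝ) :
    μ.real {ω | signSum ε (insert i J) ω = v} =
      (μ.real {ω | signSum ε J ω = v - 1} + μ.real {ω | signSum ε J ω = v + 1}) / 2 := by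
  have hS : ∀ j ∈ J, j ∈ (J : Set ℕ) := fun j hj => hj
  have hdisj : Disjoint ({i} : Set ℕ) (J : Set ℕ) := by simpa using hi
  have hmi := measurable_sign ε (Set.mem_singleton i)
  have e1 := h.measureReal_inter hdisj (hmi (measurableSet_singleton 1))
    (measurableSet_signSum_eq ε hS (v - 1))
  have e2 := h.measureReal_inter hdisj (hmi (measurableSet_singleton (-1)))
    (measurableSet_signSum_eq ε hS (v + 1))
  have p1 : μ.real (ε (i + 1) ⁻¹' {1}) = 1 / 2 := by
    have := h.prob_eq_one (i + 1) (by omega)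
    simp only [Measure.real]
    rw [show ε (i + 1) ⁻¹' {1} = {ω | ε (i + 1) ω = 1} from rfl, this]
    simp
  have p2 : μ.real (ε (i + 1) ⁻¹' {-1}) = 1 / 2 := by
    have := h.prob_eq_neg_one (i + 1) (by omega)
    simp only [Measure.real]
    rw [show ε (i + 1) ⁻¹' {-1} = {ω | ε (i + 1) ω = -1} from rfl, this]
    simp
  rw [p1] at e1
  rw [p2] at e2
  have hae : {ω | signSum ε (insert i J) ω = v} =ᵐ[μ]
      ((ε (i + 1) ⁻¹' {1} ∩ {ω | signSum ε J ω = v - 1}) ∪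
        (ε (i + 1) ⁻¹' {-1} ∩ {ω | signSum ε J ω = v + 1}) : Set Ω) := by
    filter_upwards [h.ae_eq_one_or] with ω hω
    have hs : signSum ε (insert i J) ω = ε (i + 1) ω + signSum ε J ω := by
      simp [signSum, Finset.sum_insert hi]
    apply propext
    change signSum ε (insert i J) ω = v ↔
      (ε (i + 1) ω = 1 ∧ signSum ε J ω = v - 1) ∨ (ε (i + 1) ω = -1 ∧ signSum ε J ω = v + 1)
    rw [hs]
    rcases hω i with h1 | h1 <;> rw [h1] <;> norm_num <;>
      constructor <;> intro h2 <;> linarith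
  rw [measureReal_congr hae, measureReal_union _ _, e1, e2]
  · ring
  · rw [Set.disjoint_left]
    rintro ω ⟨h1, -⟩ ⟨h2, -⟩
    simp only [Set.mem_preimage, Set.mem_singleton_iff] at h1 h2
    linarith
  · exact (h.signSigma_le _ _ (hmi (measurableSet_singleton (-1)))).inter
      (h.signSigma_le _ _ (measurableSet_signSum_eq ε hS (v + 1)))

/-- A sum of `N` independent signs has the (centred) binomial distribution. -/
lemma measureReal_signSum_eq [IsProbabilityMeasure μ] (h : IsRademacherSequence μ ε)
    (J : Finset ℕ) :
    (∀ j : ℕ, μ.real {ω | signSum ε J ω = 2 * j - J.card} = (J.card.choose j : ℝ) / 2 ^ J.card) ∧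
      ∀ j : ℕ, μ.real {ω | signSum ε J ω = -2 * (j + 1) - J.card} = 0 := by
  induction J using Finset.induction_on with
  | empty =>
    refine ⟨fun j => ?_, fun j => ?_⟩
    · rcases j with - | j
      · simp [signSum]
      · have : ¬ ((0 : ℝ) = 2 * ((j : ℝ) + 1)) := by positivity
        simp [signSum, this]
    · rw [Set.eq_empty_of_forall_notMem (s := {ω | signSum ε ∅ ω = _}) fun ω hω => ?_]
      · simp
      · have hω' : signSum ε ∅ ω = -2 * (j + 1) - ((∅ : Finset ℕ).card : ℝ) := hω
        have : (0 : ℝ) ≤ j := by positivity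
        simp only [signSum, Finset.sum_empty, Finset.card_empty, Nat.cast_zero] at hω'
        linarith
  | insert i J hi ih =>
    obtain ⟨ih1, ih2⟩ := ih
    rw [Finset.card_insert_of_notMem hi]
    refine ⟨fun j => ?_, fun j => ?_⟩
    · rw [h.measureReal_insert hi]
      have e2 : (2 * (j : ℝ) - ((J.card + 1 : ℕ) : ℝ)) + 1 = 2 * j - J.card := by push_cast; ring
      rw [e2, ih1 j]
      -- At `j = 0`, Pascal's rule reaches one step below the support; the vanishing clause of the
      -- induction covers that term.
      rcases j with - | j
      · have e1 : (2 * ((0 : ℕ) : ℝ) - ((J.card + 1 : ℕ) : ℝ)) - 1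
            = -2 * ((0 : ℕ) + 1) - J.card := by push_cast; ring
        rw [e1, ih2 0]
        simp [pow_succ]
        ring
      · have e1 : (2 * ((j + 1 : ℕ) : ℝ) - ((J.card + 1 : ℕ) : ℝ)) - 1
            = 2 * j - J.card := by push_cast; ring
        rw [e1, ih1 j, Nat.choose_succ_succ, pow_succ]
        push_cast
        field_simp
    · rw [h.measureReal_insert hi]
      have e1 : (-2 * ((j : ℝ) + 1) - ((J.card + 1 : ℕ) : ℝ)) - 1
          = -2 * ((j + 1 : ℕ) + 1) - J.card := by push_cast; ring
      have e2 : (-2 * ((j : ℝ) + 1) - ((J.card + 1 : ℕ) : ℝ)) + 1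
          = -2 * (j + 1) - J.card := by push_cast; ring
      rw [e1, e2, ih2, ih2]
      simp

end IsRademacherSequence

end Signs

/-! ### A second moment bound. -/

/-- If the pair correlations of the events `H i` are small on average, their union is likely. -/
lemma sum_div_le_measureReal_biUnion {Ω ι : Type*} [MeasurableSpace Ω] {μ : Measure Ω}
    [IsProbabilityMeasure μ] (I : Finset ι) (H : ι → Set Ω)
    (hH : ∀ i ∈ I, MeasurableSet (H i)) {G : ℝ} (hG : 0 < G)
    (hcor : ∑ i ∈ I, ∑ j ∈ I, μ.real (H i ∩ H j) ≤ 2 * G * ∑ i ∈ I, μ.real (H i)) :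
    (∑ i ∈ I, μ.real (H i)) / (2 * G) ≤ μ.real (⋃ i ∈ I, H i) := by
  have hU : MeasurableSet (⋃ i ∈ I, H i) := I.measurableSet_biUnion hH
  set Z : Ω → ℝ := fun ω => ∑ i ∈ I, (H i).indicator 1 ω with hZ
  have hint : ∀ i ∈ I, Integrable ((H i).indicator (1 : Ω → ℝ)) μ := fun i hi =>
    (integrable_const (1 : ℝ)).indicator (hH i hi)
  have hint2 : ∀ i ∈ I, ∀ j ∈ I, Integrable ((H i ∩ H j).indicator (1 : Ω → ℝ)) μ :=
    fun i hi j hj => (integrable_const (1 : ℝ)).indicator ((hH i hi).inter (hH j hj))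
  have hsq : ∀ ω, Z ω ^ 2 = ∑ i ∈ I, ∑ j ∈ I, (H i ∩ H j).indicator (1 : Ω → ℝ) ω := by
    intro ω
    rw [hZ, sq, Finset.sum_mul_sum]
    refine Finset.sum_congr rfl fun i _ => Finset.sum_congr rfl fun j _ => ?_
    rw [Set.inter_indicator_one, Pi.mul_apply]
  have hZi : Integrable Z μ := integrable_finsetSum I hint
  have hZ2i : Integrable (fun ω => Z ω ^ 2) μ := by
    simp_rw [hsq]
    exact integrable_finsetSum I fun i hi => integrable_finsetSum I fun j hj => hint2 i hi j hj
  have hEZ : ∫ ω, Z ω ∂μ = ∑ i ∈ I, μ.real (H i) := by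
    rw [hZ, integral_finsetSum I hint]
    exact Finset.sum_congr rfl fun i hi => integral_indicator_one (hH i hi)
  have hEZ2 : ∫ ω, Z ω ^ 2 ∂μ = ∑ i ∈ I, ∑ j ∈ I, μ.real (H i ∩ H j) := by
    simp_rw [hsq]
    rw [integral_finsetSum I fun i hi => integrable_finsetSum I fun j hj => hint2 i hi j hj]
    refine Finset.sum_congr rfl fun i hi => ?_
    rw [integral_finsetSum I fun j hj => hint2 i hi j hj]
    exact Finset.sum_congr rfl fun j hj => integral_indicator_one ((hH i hi).inter (hH j hj))
  -- `Z` counts the events that occur. Where `Z > 0` this is `(1 - Z / (2 G)) ^ 2 ≥ 0`; elsewhere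
  -- both sides vanish.
  have hpt : ∀ ω, Z ω / G - Z ω ^ 2 / (4 * G ^ 2) ≤
      (⋃ i ∈ I, H i).indicator (1 : Ω → ℝ) ω := by
    intro ω
    by_cases hω : ω ∈ ⋃ i ∈ I, H i
    · rw [Set.indicator_of_mem hω, Pi.one_apply]
      have := sq_nonneg (1 - Z ω / (2 * G))
      have e : (1 - Z ω / (2 * G)) ^ 2 = 1 - (Z ω / G - Z ω ^ 2 / (4 * G ^ 2)) := by
        field_simp; ring
      linarith
    · rw [Set.indicator_of_notMem hω]
      have : Z ω = 0 := by
        refine Finset.sum_eq_zero fun i hi => Set.indicator_of_notMem (fun hi' => hω ?_) _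
        exact Set.mem_biUnion hi hi'
      simp [this]
  have hL : ∫ ω, (Z ω / G - Z ω ^ 2 / (4 * G ^ 2)) ∂μ
      = (∫ ω, Z ω ∂μ) / G - (∫ ω, Z ω ^ 2 ∂μ) / (4 * G ^ 2) := by
    rw [integral_sub (hZi.div_const G) (hZ2i.div_const _), integral_div, integral_div]
  have hR : ∫ ω, (⋃ i ∈ I, H i).indicator (fun _ => (1 : ℝ)) ω ∂μ = μ.real (⋃ i ∈ I, H i) :=
    integral_indicator_one hU
  have key : (∫ ω, Z ω ∂μ) / G - (∫ ω, Z ω ^ 2 ∂μ) / (4 * G ^ 2) ≤ μ.real (⋃ i ∈ I, H i) :=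
    hL ▸ hR ▸ integral_mono ((hZi.div_const G).sub (hZ2i.div_const (4 * G ^ 2)))
      ((integrable_const (1 : ℝ)).indicator hU) hpt
  rw [hEZ, hEZ2] at key
  refine le_trans ?_ key
  set s := ∑ i ∈ I, μ.real (H i)
  have : (∑ i ∈ I, ∑ j ∈ I, μ.real (H i ∩ H j)) / (4 * G ^ 2) ≤ (2 * G * s) / (4 * G ^ 2) := by
    gcongr
  have e : (2 * G * s) / (4 * G ^ 2) = s / G - s / (2 * G) := by field_simp; ring
  linarith

/-! ### Estimates for binomial coefficients. -/

/-- Bounds the return probability of a simple walk at time `2 n` by `1 / √(2 n + 1)`; the induction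
rests on `(2 n + 1) (2 n + 3) ≤ 4 (n + 1) ^ 2`. -/
lemma centralBinom_sq_mul_le (n : ℕ) : n.centralBinom ^ 2 * (2 * n + 1) ≤ 16 ^ n := by
  induction n with
  | zero => simp
  | succ n ih =>
    have h := Nat.succ_mul_centralBinom_succ n
    have h2 : (n + 1) ^ 2 * ((n + 1).centralBinom ^ 2 * (2 * (n + 1) + 1)) ≤
        (n + 1) ^ 2 * 16 ^ (n + 1) := by
      calc (n + 1) ^ 2 * ((n + 1).centralBinom ^ 2 * (2 * (n + 1) + 1))
          = ((n + 1) * (n + 1).centralBinom) ^ 2 * (2 * n + 3) := by ring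
        _ = n.centralBinom ^ 2 * (2 * n + 1) * (4 * ((2 * n + 1) * (2 * n + 3))) := by
          rw [h]; ring
        _ ≤ 16 ^ n * (4 * (4 * (n + 1) ^ 2)) := Nat.mul_le_mul ih (by nlinarith)
        _ = _ := by ring
    exact Nat.le_of_mul_le_mul_left h2 (by positivity)

/-- The matching lower bound, from `4 n (n + 1) ≤ (2 n + 1) ^ 2`. -/
lemma pow_le_mul_centralBinom_sq {n : ℕ} (hn : 1 ≤ n) :
    16 ^ n ≤ 4 * n * n.centralBinom ^ 2 := by
  induction n, hn using Nat.le_induction with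
  | base => simp [Nat.centralBinom, Nat.choose]
  | succ n hn ih =>
    have h := Nat.succ_mul_centralBinom_succ n
    have h2 : (n + 1) * 16 ^ (n + 1) ≤
        (n + 1) * (4 * (n + 1) * (n + 1).centralBinom ^ 2) := by
      calc (n + 1) * 16 ^ (n + 1) = 16 * (n + 1) * 16 ^ n := by ring
        _ ≤ 16 * (n + 1) * (4 * n * n.centralBinom ^ 2) := by gcongr
        _ = 16 * (4 * n * (n + 1)) * n.centralBinom ^ 2 := by ring
        _ ≤ 16 * (2 * n + 1) ^ 2 * n.centralBinom ^ 2 := by gcongr; nlinarith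
        _ = 4 * ((n + 1) * (n + 1).centralBinom) ^ 2 := by rw [h]; ring
        _ = _ := by ring
    exact Nat.le_of_mul_le_mul_left h2 (by positivity)

/-- Moving from `n + b` to `n + b + 1` multiplies the coefficient by `(n - b) / (n + b + 1)`, which
is at least `1 - 2 a / n` while `b < a`. -/
lemma centralBinom_mul_pow_le_choose {n a : ℕ} (han : 4 * a ≤ n) :
    (n.centralBinom : ℝ) * (1 - 2 * a / n) ^ a ≤ (2 * n).choose (n + a) := by
  rcases Nat.eq_zero_or_pos n with rfl | hn
  · obtain rfl : a = 0 := by omega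
    simp
  have hn' : (0 : ℝ) < n := by exact_mod_cast hn
  have han' : (4 * a : ℝ) ≤ n := by exact_mod_cast han
  have hx : 0 ≤ 1 - 2 * (a : ℝ) / n := by
    rw [sub_nonneg, div_le_one hn']; linarith [(Nat.cast_nonneg a : (0 : ℝ) ≤ a)]
  suffices ∀ b ≤ a, (n.centralBinom : ℝ) * (1 - 2 * a / n) ^ b ≤ (2 * n).choose (n + b) from
    this a le_rfl
  intro b
  induction b with
  | zero => intro _; simp [Nat.centralBinom]
  | succ b ih =>
    intro hb
    have ih := ih (by omega)
    have hch := Nat.choose_succ_right_eq (2 * n) (n + b)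
    have hch' : ((2 * n).choose (n + b + 1) : ℝ) * (n + b + 1) =
        (2 * n).choose (n + b) * (n - b) := by
      have := congrArg (Nat.cast : ℕ → ℝ) hch
      rw [show 2 * n - (n + b) = n - b by omega] at this
      push_cast [Nat.cast_sub (show b ≤ n by omega)] at this
      exact this
    have hb' : (b : ℝ) + 1 ≤ a := by exact_mod_cast hb
    have hb0 : (0 : ℝ) ≤ b := by positivity
    have hr : (1 - 2 * (a : ℝ) / n) ≤ (n - b) / (n + b + 1) := by
      rw [le_div_iff₀ (by positivity), sub_mul, div_mul_eq_mul_div, sub_le_iff_le_add,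
        ← sub_le_iff_le_add', le_div_iff₀ hn']
      nlinarith
    rw [show ((2 * n).choose (n + (b + 1)) : ℝ) =
      (2 * n).choose (n + b) * ((n - b) / (n + b + 1)) by
        rw [← add_assoc, ← mul_div_assoc, ← hch']; field_simp]
    calc (n.centralBinom : ℝ) * (1 - 2 * a / n) ^ (b + 1)
        = (n.centralBinom * (1 - 2 * a / n) ^ b) * (1 - 2 * a / n) := by ring
      _ ≤ _ := by gcongr

lemma exp_neg_two_mul_le {x : ℝ} (h0 : 0 ≤ x) (h1 : x ≤ 1 / 2) :
    Real.exp (-(2 * x)) ≤ 1 - x := by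
  have h := Real.add_one_le_exp (2 * x)
  rw [Real.exp_neg, inv_le_comm₀ (Real.exp_pos _) (by linarith), inv_le_iff_one_le_mul₀ (by linarith)]
  nlinarith

/-- A local limit lower bound for the symmetric binomial distribution. -/
lemma exp_div_le_choose_div {n a : ℕ} (hn : 1 ≤ n) (han : 4 * a ≤ n) :
    Real.exp (-(4 * a ^ 2 / n)) / (2 * √n) ≤ ((2 * n).choose (n + a) : ℝ) / 4 ^ n := by
  have hn' : (0 : ℝ) < n := by exact_mod_cast hn
  have han' : (4 * a : ℝ) ≤ n := by exact_mod_cast han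
  have h1 : Real.exp (-(4 * a ^ 2 / n)) ≤ (1 - 2 * (a : ℝ) / n) ^ a := by
    have := exp_neg_two_mul_le (x := 2 * (a : ℝ) / n) (by positivity)
      (by rw [div_le_iff₀ hn']; linarith)
    calc Real.exp (-(4 * a ^ 2 / n)) = Real.exp (-(2 * (2 * (a : ℝ) / n))) ^ a := by
          rw [← Real.exp_nat_mul]; congr 1; ring
      _ ≤ _ := by gcongr
  have h2 : (4 : ℝ) ^ n ≤ 2 * √n * n.centralBinom := by
    refine (sq_le_sq₀ (by positivity) (by positivity)).1 ?_
    rw [mul_pow, mul_pow, Real.sq_sqrt hn'.le, ← pow_mul, mul_comm n 2, pow_mul]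
    have := pow_le_mul_centralBinom_sq hn
    norm_num
    exact_mod_cast this
  have h3 := centralBinom_mul_pow_le_choose han
  rw [div_le_div_iff₀ (by positivity) (by positivity)]
  calc Real.exp (-(4 * a ^ 2 / n)) * 4 ^ n
      ≤ Real.exp (-(4 * a ^ 2 / n)) * (2 * √n * n.centralBinom) := by gcongr
    _ ≤ (1 - 2 * (a : ℝ) / n) ^ a * (2 * √n * n.centralBinom) := by gcongr
    _ = (n.centralBinom * (1 - 2 * (a : ℝ) / n) ^ a) * (2 * √n) := by ring
    _ ≤ _ := by gcongr

lemma centralBinom_div_sq_le (n : ℕ) :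
    ((n.centralBinom : ℝ) / 4 ^ n) ^ 2 ≤ 1 / (n + 1) := by
  have h : ((n.centralBinom : ℝ)) ^ 2 * (2 * n + 1) ≤ 16 ^ n := by
    exact_mod_cast centralBinom_sq_mul_le n
  rw [div_pow, ← pow_mul, mul_comm n 2, pow_mul, div_le_div_iff₀ (by positivity) (by positivity)]
  norm_num
  refine le_trans ?_ h
  gcongr
  linarith [(Nat.cast_nonneg n : (0 : ℝ) ≤ n)]

/-- The expected number of returns of the planar walk: squaring the one-dimensional return
probability gives a harmonic sum, hence a logarithm of `4 ^ k`. -/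
lemma sum_centralBinom_div_sq_le {k M : ℕ} (hk : 1 ≤ k) (hM : M ≤ 4 ^ k) :
    ∑ d ∈ Finset.range M, ((d.centralBinom : ℝ) / 4 ^ d) ^ 2 ≤ (3 : ℝ) * k := by
  have hk' : (1 : ℝ) ≤ k := by exact_mod_cast hk
  have h1 : ∑ d ∈ Finset.range M, ((d.centralBinom : ℝ) / 4 ^ d) ^ 2 ≤ (harmonic (4 ^ k) : ℝ) := by
    rw [harmonic]
    push_cast
    refine (Finset.sum_le_sum_of_subset_of_nonneg (Finset.range_subset_range.2 hM)
      fun _ _ _ => by positivity).trans (Finset.sum_le_sum fun d _ => ?_)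
    simpa using centralBinom_div_sq_le d
  have h2 := harmonic_le_one_add_log (4 ^ k)
  have h3 : Real.log ((4 ^ k : ℕ) : ℝ) ≤ 2 * k := by
    push_cast
    rw [Real.log_pow, show (4 : ℝ) = 2 ^ 2 by norm_num, Real.log_pow]
    have := Real.log_two_lt_d9
    push_cast
    nlinarith
  linarith

/-! ### Arithmetic of the step sizes. -/

/-- Bounded integer representations by the coprime numbers `w + 1` and `w - 1`. -/
lemma exists_repr {w y : ℤ} {L : ℕ} (hw : 2 ≤ w) (hw2 : Even w) (hy : |y| ≤ L * w ^ 2) :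
    ∃ a b : ℤ, (w + 1) * a + (w - 1) * b = y ∧ |a| ≤ (L + 2) * w ∧ |b| ≤ (L + 2) * w := by
  -- Since `(w + 1) a + (w - 1) b = w (a + b) + (a - b)`, it suffices to solve `a + b = q`, `a - b =
  -- ρ`, which needs `q` and `ρ` of equal parity.
  have key : ∀ q ρ : ℤ, w * q + ρ = y → |q| ≤ L * w + 2 → |ρ| ≤ w → Even (q + ρ) →
      ∃ a b : ℤ, (w + 1) * a + (w - 1) * b = y ∧ |a| ≤ (L + 2) * w ∧ |b| ≤ (L + 2) * w := by
    rintro q ρ h hq hρ ⟨a, ha⟩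
    have hL : 0 ≤ (L : ℤ) * w := by positivity
    rw [abs_le] at hq hρ
    refine ⟨a, a - ρ, ?_, ?_, ?_⟩
    · obtain rfl : q = 2 * a - ρ := by linarith
      rw [← h]; ring
    · rw [abs_le]; constructor <;> nlinarith
    · rw [abs_le]; constructor <;> nlinarith
  have h1 := Int.mul_ediv_add_emod y w
  have h2 := Int.emod_nonneg y (show w ≠ 0 by omega)
  have h3 := Int.emod_lt_of_pos y (show 0 < w by omega)
  rw [abs_le] at hy
  have hq1 : y / w ≤ L * w := Int.ediv_le_of_le_mul (by omega) (by nlinarith)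
  have hq2 : -(L * w) ≤ y / w := Int.le_ediv_of_mul_le (by omega) (by nlinarith)
  rcases Int.even_or_odd (y / w + y % w) with he | ho
  · exact key _ _ h1 (abs_le.2 ⟨by linarith, by linarith⟩)
      (abs_le.2 ⟨by linarith, by linarith⟩) he
  -- Replacing `(q, ρ)` by `(q + 1, ρ - w)` keeps `w q + ρ` and, `w` being even, flips the parity of
  -- `q + ρ`.
  · refine key (y / w + 1) (y % w - w) (by linarith) (abs_le.2 ⟨by linarith, by linarith⟩)
      (abs_le.2 ⟨by linarith, by linarith⟩) ?_
    rw [show y / w + 1 + (y % w - w) = (y / w + y % w + 1) - w by ring]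
    exact ho.add_one.sub hw2

/-! ### Hitting probabilities for two interleaved walks. -/

/-- The indices `s + 2 l` with `i ≤ l < j`. -/
def stride (s i j : ℕ) : Finset ℕ := (Finset.Ico i j).image fun l => s + 2 * l

lemma card_stride (s i j : ℕ) : (stride s i j).card = j - i := by
  rw [stride, Finset.card_image_of_injective _ fun x y h => by simpa using h, Nat.card_Ico]

lemma signSum_stride {Ω : Type*} (ε : ℕ → Ω → ℝ) (s i j : ℕ) (ω : Ω) :
    signSum ε (stride s i j) ω = ∑ l ∈ Finset.Ico i j, ε (s + 2 * l + 1) ω := by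
  rw [signSum, stride, Finset.sum_image fun x _ y _ h => by simpa using h]

lemma signSum_stride_add {Ω : Type*} (ε : ℕ → Ω → ℝ) (s : ℕ) {i j : ℕ} (hij : i ≤ j) (ω : Ω) :
    signSum ε (stride s 0 j) ω = signSum ε (stride s 0 i) ω + signSum ε (stride s i j) ω := by
  simp only [signSum_stride]
  exact (Finset.sum_Ico_consecutive _ (Nat.zero_le i) hij).symm

/-- The signs at positions `s + 2 l` sum to `2 a`, and those at positions `s + 2 l + 1` to `2 b`,
over `2 i ≤ l < 2 j`. -/
def pairEvent {Ω : Type*} (ε : ℕ → Ω → ℝ) (s i j : ℕ) (a b : ℤ) : Set Ω :=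
  {ω | signSum ε (stride s (2 * i) (2 * j)) ω = 2 * a} ∩
    {ω | signSum ε (stride (s + 1) (2 * i) (2 * j)) ω = 2 * b}

lemma measurableSet_pairEvent {Ω : Type*} (ε : ℕ → Ω → ℝ) (s i j : ℕ) (a b : ℤ) :
    MeasurableSet[signSigma ε (Set.Ico (s + 4 * i) (s + 4 * j))] (pairEvent ε s i j a b) := by
  refine (measurableSet_signSum_eq ε (fun l hl => ?_) _).inter
    (measurableSet_signSum_eq ε (fun l hl => ?_) _) <;>
  · simp only [stride, Finset.mem_image, Finset.mem_Ico] at hl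
    obtain ⟨x, hx, rfl⟩ := hl
    rw [Set.mem_Ico]
    omega

/-- Two visits to one point amount to a first visit followed by a null displacement, and these
depend on disjoint sets of signs. -/
lemma pairEvent_inter {Ω : Type*} (ε : ℕ → Ω → ℝ) (s : ℕ) {i j : ℕ} (hij : i ≤ j) (a b : ℤ) :
    pairEvent ε s 0 i a b ∩ pairEvent ε s 0 j a b =
      pairEvent ε s 0 i a b ∩ pairEvent ε s i j 0 0 := by
  ext ω
  have h1 := signSum_stride_add ε s (show 2 * i ≤ 2 * j by omega) ω
  have h2 := signSum_stride_add ε (s + 1) (show 2 * i ≤ 2 * j by omega) ω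
  simp only [pairEvent, Set.mem_inter_iff, Set.mem_ofPred_eq, mul_zero, Int.cast_zero]
  constructor <;> rintro ⟨⟨h3, h4⟩, h5, h6⟩ <;>
    exact ⟨⟨h3, h4⟩, by linarith, by linarith⟩

namespace IsRademacherSequence

variable {Ω : Type*} [MeasurableSpace Ω] {μ : Measure Ω} [IsProbabilityMeasure μ]
  {ε : ℕ → Ω → ℝ}

lemma measureReal_signSum_eq_two_mul (h : IsRademacherSequence μ ε) {J : Finset ℕ} {n : ℕ}
    (hJ : J.card = 2 * n) {a : ℤ} (ha : a.natAbs ≤ n) :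
    μ.real {ω | signSum ε J ω = 2 * a} = ((2 * n).choose (n + a.natAbs) : ℝ) / 4 ^ n := by
  have h1 := (h.measureReal_signSum_eq J).1
  rw [hJ] at h1
  rw [show (4 : ℝ) ^ n = 2 ^ (2 * n) by rw [pow_mul]; norm_num]
  rcases Int.natAbs_eq a with h2 | h2
  · rw [← h1 (n + a.natAbs)]
    congr 2
    ext ω
    have : (a : ℝ) = (a.natAbs : ℝ) :=
      (congrArg (Int.cast : ℤ → ℝ) h2).trans (Int.cast_natCast _)
    rw [this]
    push_cast
    ring_nf
  · rw [← Nat.choose_symm_of_eq_add (show 2 * n = (n - a.natAbs) + (n + a.natAbs) by omega),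
      ← h1 (n - a.natAbs)]
    congr 2
    ext ω
    have : (a : ℝ) = -(a.natAbs : ℝ) := by exact_mod_cast congrArg (Int.cast : ℤ → ℝ) h2
    rw [this]
    push_cast [Nat.cast_sub ha]
    ring_nf

lemma measureReal_pairEvent (h : IsRademacherSequence μ ε) (s i j : ℕ) {a b : ℤ}
    (ha : a.natAbs ≤ j - i) (hb : b.natAbs ≤ j - i) :
    μ.real (pairEvent ε s i j a b) =
      (((2 * (j - i)).choose (j - i + a.natAbs) : ℝ) / 4 ^ (j - i)) *
        (((2 * (j - i)).choose (j - i + b.natAbs) : ℝ) / 4 ^ (j - i)) := by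
  have hd : Disjoint (stride s (2 * i) (2 * j) : Set ℕ) (stride (s + 1) (2 * i) (2 * j)) := by
    rw [Finset.disjoint_coe, Finset.disjoint_left]
    intro x hx hy
    simp only [stride, Finset.mem_image] at hx hy
    obtain ⟨l, -, rfl⟩ := hx
    obtain ⟨l', -, h⟩ := hy
    omega
  rw [pairEvent, h.measureReal_inter hd (measurableSet_signSum_eq ε (fun l hl => hl) _)
    (measurableSet_signSum_eq ε (fun l hl => hl) _),
    h.measureReal_signSum_eq_two_mul (by rw [card_stride]; omega) ha,
    h.measureReal_signSum_eq_two_mul (by rw [card_stride]; omega) hb]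

lemma measureReal_pairEvent_zero (h : IsRademacherSequence μ ε) (s i j : ℕ) :
    μ.real (pairEvent ε s i j 0 0) = (((j - i).centralBinom : ℝ) / 4 ^ (j - i)) ^ 2 := by
  rw [h.measureReal_pairEvent s i j (by simp) (by simp), sq]
  simp [Nat.centralBinom]

lemma measureReal_pairEvent_inter (h : IsRademacherSequence μ ε) (s : ℕ) {i j : ℕ} (hij : i ≤ j)
    (a b : ℤ) :
    μ.real (pairEvent ε s 0 i a b ∩ pairEvent ε s 0 j a b) =
      μ.real (pairEvent ε s 0 i a b) * (((j - i).centralBinom : ℝ) / 4 ^ (j - i)) ^ 2 := by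
  rw [pairEvent_inter ε s hij, h.measureReal_inter _ (measurableSet_pairEvent ε s 0 i a b)
    (measurableSet_pairEvent ε s i j 0 0), h.measureReal_pairEvent_zero]
  rw [Set.disjoint_left]
  intro x hx hy
  rw [Set.mem_Ico] at hx hy
  omega

/-- After a visit at time `i`, the expected number of visits at times `j ≥ i` is at most `3 k`;
symmetry in `i` and `j` gives the factor `2`. -/
lemma sum_measureReal_pairEvent_inter_le (h : IsRademacherSequence μ ε) (s : ℕ) (a b : ℤ)
    {k m M : ℕ} (hk : 1 ≤ k) (hM : M ≤ 4 ^ k) :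
    ∑ i ∈ Finset.Ioc m M, ∑ j ∈ Finset.Ioc m M,
        μ.real (pairEvent ε s 0 i a b ∩ pairEvent ε s 0 j a b) ≤
      2 * (3 * k) * ∑ i ∈ Finset.Ioc m M, μ.real (pairEvent ε s 0 i a b) := by
  set P : ℕ → ℝ := fun i => μ.real (pairEvent ε s 0 i a b) with hP
  set g : ℕ → ℝ := fun d => ((d.centralBinom : ℝ) / 4 ^ d) ^ 2 with hg
  have hg0 : ∀ d, 0 ≤ g d := fun d => sq_nonneg _
  have hP0 : ∀ d, 0 ≤ P d := fun d => measureReal_nonneg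
  set f : ℕ → ℕ → ℝ := fun i j => if i ≤ j then P i * g (j - i) else 0 with hf
  have hf0 : ∀ i j, 0 ≤ f i j := fun i j => by
    simp only [hf]
    split_ifs
    exacts [mul_nonneg (hP0 _) (hg0 _), le_rfl]
  have hle : ∀ i j, μ.real (pairEvent ε s 0 i a b ∩ pairEvent ε s 0 j a b) ≤ f i j + f j i := by
    intro i j
    rcases le_total i j with hij | hij
    · rw [h.measureReal_pairEvent_inter s hij]
      have : P i * g (j - i) = f i j := by simp [hf, hij]
      change P i * g (j - i) ≤ _
      linarith [hf0 j i]
    · rw [Set.inter_comm, h.measureReal_pairEvent_inter s hij]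
      have : P j * g (i - j) = f j i := by simp [hf, hij]
      change P j * g (i - j) ≤ _
      linarith [hf0 i j]
  have hsum : ∀ i ∈ Finset.Ioc m M, ∑ j ∈ Finset.Ioc m M, f i j ≤ P i * (3 * k) := by
    intro i hi
    simp only [hf]
    rw [← Finset.sum_filter, ← Finset.mul_sum]
    refine mul_le_mul_of_nonneg_left ?_ (hP0 i)
    refine le_trans ?_ (sum_centralBinom_div_sq_le hk hM)
    rw [← Finset.sum_image (f := g) (g := fun j => j - i)]
    · refine Finset.sum_le_sum_of_subset_of_nonneg ?_ fun _ _ _ => hg0 _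
      intro d hd
      simp only [Finset.mem_image, Finset.mem_filter, Finset.mem_Ioc] at hd hi
      obtain ⟨x, hx, rfl⟩ := hd
      rw [Finset.mem_range]
      omega
    · intro x hx y hy hxy
      simp only [Finset.coe_filter, Set.mem_ofPred_eq] at hx hy hxy
      omega
  calc _ ≤ ∑ i ∈ Finset.Ioc m M, ∑ j ∈ Finset.Ioc m M, (f i j + f j i) :=
        Finset.sum_le_sum fun i _ => Finset.sum_le_sum fun j _ => hle i j
    _ = 2 * ∑ i ∈ Finset.Ioc m M, ∑ j ∈ Finset.Ioc m M, f i j := by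
        simp_rw [Finset.sum_add_distrib]
        rw [Finset.sum_comm (f := fun i j => f j i), two_mul]
    _ ≤ 2 * ∑ i ∈ Finset.Ioc m M, P i * (3 * k) := by gcongr with i hi; exact hsum i hi
    _ = _ := by rw [← Finset.sum_mul]; ring

/-- The local limit bound is applied to each coordinate: `n > r ^ 2` controls the exponent, and `n ≤
2 r ^ 2` the factor `1 / (4 n)`. -/
lemma exp_div_le_measureReal_pairEvent (h : IsRademacherSequence μ ε) (s : ℕ) {A r n : ℕ}
    {a b : ℤ} (hAr : 4 * A ≤ r) (ha : a.natAbs ≤ A * r) (hb : b.natAbs ≤ A * r)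
    (hn : n ∈ Finset.Ioc (r ^ 2) (2 * r ^ 2)) :
    Real.exp (-(8 * A ^ 2)) / (8 * r ^ 2) ≤ μ.real (pairEvent ε s 0 n a b) := by
  rw [Finset.mem_Ioc] at hn
  have h4 : 4 * (A * r) ≤ r ^ 2 := by nlinarith
  have hn1 : 1 ≤ n := by omega
  have hn0 : (0 : ℝ) < n := by exact_mod_cast hn1
  have key : ∀ c : ℤ, c.natAbs ≤ A * r → Real.exp (-(4 * A ^ 2)) / (2 * √n) ≤
      ((2 * n).choose (n + c.natAbs) : ℝ) / 4 ^ n := by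
    intro c hc
    refine le_trans ?_ (exp_div_le_choose_div hn1 (show 4 * c.natAbs ≤ n by omega))
    gcongr ?_ / _
    rw [Real.exp_le_exp, neg_le_neg_iff, div_le_iff₀ hn0]
    have h1 : (c.natAbs : ℝ) ≤ A * r := by exact_mod_cast hc
    have h2 : (r : ℝ) ^ 2 ≤ n := by exact_mod_cast hn.1.le
    calc 4 * (c.natAbs : ℝ) ^ 2 ≤ 4 * ((A : ℝ) * r) ^ 2 := by gcongr
      _ = 4 * (A : ℝ) ^ 2 * (r : ℝ) ^ 2 := by ring
      _ ≤ _ := by gcongr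
  rw [h.measureReal_pairEvent s 0 n (by omega) (by omega), Nat.sub_zero]
  refine le_trans ?_ (mul_le_mul (key a ha) (key b hb) (by positivity) (by positivity))
  have hn2 : (n : ℝ) ≤ 2 * r ^ 2 := by exact_mod_cast hn.2
  rw [div_mul_div_comm, ← Real.exp_add,
    show 2 * √(n : ℝ) * (2 * √n) = 4 * n by nlinarith [Real.mul_self_sqrt hn0.le],
    show -(4 * (A : ℝ) ^ 2) + -(4 * A ^ 2) = -(8 * A ^ 2) by ring]
  exact div_le_div_of_nonneg_left (Real.exp_pos _).le (by positivity) (by linarith)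

/-- Two independent simple random walks meet a given point at distance `O(r)` within time `O(r²)`
with probability at least of order `1 / log r`. -/
lemma exp_div_le_measureReal_biUnion_pairEvent (h : IsRademacherSequence μ ε) (s : ℕ)
    {A r k : ℕ} {a b : ℤ} (hr : 1 ≤ r) (hAr : 4 * A ≤ r) (ha : a.natAbs ≤ A * r)
    (hb : b.natAbs ≤ A * r) (hk : 1 ≤ k) (hrk : 2 * r ^ 2 ≤ 4 ^ k) :
    Real.exp (-(8 * A ^ 2)) / 48 / k ≤
      μ.real (⋃ n ∈ Finset.Ioc (r ^ 2) (2 * r ^ 2), pairEvent ε s 0 n a b) := by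
  have hk0 : (0 : ℝ) < k := by exact_mod_cast hk
  have hr0 : (0 : ℝ) < r := by exact_mod_cast hr
  refine le_trans ?_ (sum_div_le_measureReal_biUnion _ _
    (fun n _ => h.signSigma_le _ _ (measurableSet_pairEvent ε s 0 n a b))
    (show (0 : ℝ) < 3 * k by positivity)
    (h.sum_measureReal_pairEvent_inter_le s a b hk hrk))
  -- There are `r ^ 2` times, each contributing at least `exp (-8 A ^ 2) / (8 r ^ 2)`; dividing by
  -- `2 * (3 k)` yields the constant `48`.
  have := Finset.card_nsmul_le_sum _ _ _ fun n hn =>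
    h.exp_div_le_measureReal_pairEvent s hAr ha hb hn
  rw [Nat.card_Ioc, show 2 * r ^ 2 - r ^ 2 = r ^ 2 by omega, nsmul_eq_mul] at this
  calc _ = ((r ^ 2 : ℕ) * (Real.exp (-(8 * A ^ 2)) / (8 * r ^ 2))) / (2 * (3 * k)) := by
        push_cast; field_simp; norm_num
    _ ≤ _ := by gcongr

end IsRademacherSequence

/-! ### The explicit step sequence. -/

/-- By this closed form, `n` lies in block `k` exactly when `4 ^ k ≤ 6 n - 2 < 4 ^ (k + 1)`, so
`Nat.log 4 (6 * n - 2)` recovers the block number. -/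
lemma six_mul_blockStart {k : ℕ} (hk : 1 ≤ k) : 6 * blockStart k = 4 ^ k + 2 := by
  induction k, hk using Nat.le_induction with
  | base => simp [blockStart]
  | succ k hk ih =>
    have h : blockStart (k + 1) = blockStart k + 4 ^ k / 2 := by
      rw [blockStart, blockStart, Finset.sum_Ico_succ_top hk, add_assoc]
    obtain ⟨j, rfl⟩ := Nat.exists_eq_add_of_le' hk
    rw [h, mul_add, ih, pow_succ, pow_succ]
    omega

/-- The steps of size `2 ^ k ± 1`, alternating within the `k`-th block. -/
def blockStep (n : ℕ) : ℤ :=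
  if Even (n - blockStart (Nat.log 4 (6 * n - 2))) then 2 ^ Nat.log 4 (6 * n - 2) + 1
  else 2 ^ Nat.log 4 (6 * n - 2) - 1

lemma one_le_log_six_mul_sub {n : ℕ} (hn : 1 ≤ n) : 1 ≤ Nat.log 4 (6 * n - 2) :=
  Nat.log_pos (by norm_num) (by omega)

lemma blockStep_blockStart_add {k j : ℕ} (hk : 1 ≤ k) (hj : j < 4 ^ k / 2) :
    blockStep (blockStart k + j) = if Even j then 2 ^ k + 1 else 2 ^ k - 1 := by
  have h := six_mul_blockStart hk
  have hl : Nat.log 4 (6 * (blockStart k + j) - 2) = k :=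
    Nat.log_eq_of_pow_le_of_lt_pow (by omega) (by rw [pow_succ]; omega)
  rw [blockStep, hl, Nat.add_sub_cancel_left]

lemma blockStep_mem_Icc (n : ℕ) :
    blockStep n ∈ Set.Icc ((2 : ℤ) ^ Nat.log 4 (6 * n - 2) - 1)
      (2 ^ Nat.log 4 (6 * n - 2) + 1) := by
  rw [blockStep]
  split_ifs <;> constructor <;> linarith

lemma blockStep_nonneg (n : ℕ) : 0 ≤ blockStep n := by
  have h := (blockStep_mem_Icc n).1
  have : (0 : ℤ) < 2 ^ Nat.log 4 (6 * n - 2) := by positivity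
  omega

lemma odd_blockStep {n : ℕ} (hn : 1 ≤ n) : Odd (blockStep n) := by
  have h : Even ((2 : ℤ) ^ Nat.log 4 (6 * n - 2)) :=
    even_two.pow_of_ne_zero (Nat.one_le_iff_ne_zero.1 (one_le_log_six_mul_sub hn))
  rw [blockStep]
  split_ifs
  exacts [h.add_one, h.sub_odd odd_one]

lemma blockStep_le_two_pow {n k : ℕ} (hk : 1 ≤ k) (hn : n < blockStart k) :
    blockStep n ≤ 2 ^ k := by
  have h := six_mul_blockStart hk
  have hl : Nat.log 4 (6 * n - 2) < k := by
    rcases Nat.eq_zero_or_pos (6 * n - 2) with h0 | h0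
    · rw [h0, Nat.log_zero_right]; omega
    · exact Nat.log_lt_of_lt_pow h0.ne' (by omega)
  refine (blockStep_mem_Icc n).2.trans ?_
  have h1 : (2 : ℤ) ^ (Nat.log 4 (6 * n - 2) + 1) ≤ 2 ^ k :=
    pow_le_pow_right₀ (by norm_num) hl
  have h2 : (0 : ℤ) < 2 ^ Nat.log 4 (6 * n - 2) := by positivity
  rw [pow_succ] at h1
  omega

lemma blockStep_isTheta :
    (fun n : ℕ => (blockStep n : ℝ)) =Θ[atTop] (fun n : ℕ => (n : ℝ) ^ (1 / 2 : ℝ)) := by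
  have key : ∀ n : ℕ, 1 ≤ n → (blockStep n : ℝ) ≤ 6 * √n ∧ √n ≤ 4 * blockStep n := by
    intro n hn
    have h1 := one_le_log_six_mul_sub hn
    have h2 := blockStep_mem_Icc n
    have h3 : 4 ^ Nat.log 4 (6 * n - 2) ≤ 6 * n - 2 := Nat.pow_log_le_self 4 (by omega)
    have h4 : 6 * n - 2 < 4 ^ (Nat.log 4 (6 * n - 2) + 1) :=
      Nat.lt_pow_succ_log_self (by norm_num) _
    set k := Nat.log 4 (6 * n - 2)
    have h5 : ((2 : ℝ) ^ k) ^ 2 ≤ 6 * n := by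
      rw [← pow_mul, mul_comm, pow_mul]
      norm_num
      exact_mod_cast (show 4 ^ k ≤ 6 * n by omega)
    have h6 : (n : ℝ) ≤ 4 * ((2 : ℝ) ^ k) ^ 2 := by
      rw [← pow_mul, mul_comm k 2, pow_mul]
      norm_num
      rw [pow_succ] at h4
      exact_mod_cast (show n ≤ 4 * 4 ^ k by omega)
    have h7 : (2 : ℝ) ≤ 2 ^ k := by
      simpa using pow_le_pow_right₀ (show (1 : ℝ) ≤ 2 by norm_num) h1
    have h8 : (2 : ℝ) ^ k - 1 ≤ blockStep n := by exact_mod_cast h2.1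
    have h9 : (blockStep n : ℝ) ≤ 2 ^ k + 1 := by exact_mod_cast h2.2
    have h10 := Real.sq_sqrt (Nat.cast_nonneg n : (0 : ℝ) ≤ n)
    have h11 := Real.sqrt_nonneg (n : ℝ)
    have h12 : (2 : ℝ) ^ k ≤ 3 * √n := by nlinarith
    have h13 : √(n : ℝ) ≤ 2 * 2 ^ k := by nlinarith
    constructor <;> linarith
  constructor
  · refine IsBigO.of_bound 6 ?_
    filter_upwards [eventually_ge_atTop 1] with n hn
    have h0 : (0 : ℝ) ≤ blockStep n := by exact_mod_cast blockStep_nonneg n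
    rw [← Real.sqrt_eq_rpow, Real.norm_of_nonneg h0, Real.norm_of_nonneg (Real.sqrt_nonneg _)]
    exact (key n hn).1
  · refine IsBigO.of_bound 4 ?_
    filter_upwards [eventually_ge_atTop 1] with n hn
    have h0 : (0 : ℝ) ≤ blockStep n := by exact_mod_cast blockStep_nonneg n
    rw [← Real.sqrt_eq_rpow, Real.norm_of_nonneg h0, Real.norm_of_nonneg (Real.sqrt_nonneg _)]
    exact (key n hn).2

/-! ### The walk inside a block and at block boundaries. -/

/-- The Rademacher walk with steps `blockStep`. -/
abbrev blockWalk {Ω : Type*} (ε : ℕ → Ω → ℝ) : ℕ → Ω → ℝ :=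
  rademacherWalk (fun n => (blockStep n : ℝ)) ε

/-- The number of steps before the `k`-th block. -/
def blockTime (k : ℕ) : ℕ := blockStart k - 1

lemma six_mul_blockTime {k : ℕ} (hk : 1 ≤ k) : 6 * blockTime k + 4 = 4 ^ k := by
  have := six_mul_blockStart hk
  have := Nat.pow_le_pow_right (show 0 < 4 by norm_num) hk
  rw [blockTime]
  omega

lemma blockTime_succ {k : ℕ} (hk : 1 ≤ k) : blockTime (k + 1) = blockTime k + 4 ^ k / 2 := by
  have h1 := six_mul_blockTime hk
  have h2 := six_mul_blockTime (Nat.le_succ_of_le hk)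
  rw [Nat.succ_eq_add_one, pow_succ] at h2
  omega

lemma blockTime_mono {i j : ℕ} (hi : 1 ≤ i) (hij : i ≤ j) : blockTime i ≤ blockTime j := by
  have h1 := six_mul_blockTime hi
  have h2 := six_mul_blockTime (hi.trans hij)
  have h3 := Nat.pow_le_pow_right (show 0 < 4 by norm_num) hij
  omega

lemma rademacherWalk_succ {Ω : Type*} (a : ℕ → ℝ) (ε : ℕ → Ω → ℝ) (n : ℕ) (ω : Ω) :
    rademacherWalk a ε (n + 1) ω = rademacherWalk a ε n ω + ε (n + 1) ω * a (n + 1) := by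
  rw [rademacherWalk, rademacherWalk, Finset.sum_Icc_succ_top (by omega)]

lemma rademacherWalk_eq_sum_range {Ω : Type*} (a : ℕ → ℝ) (ε : ℕ → Ω → ℝ) (n : ℕ) (ω : Ω) :
    rademacherWalk a ε n ω = ∑ i ∈ Finset.range n, ε (i + 1) ω * a (i + 1) := by
  induction n with
  | zero => simp [rademacherWalk]
  | succ n ih => rw [rademacherWalk_succ, Finset.sum_range_succ, ih]

lemma measurable_rademacherWalk {Ω : Type*} (a : ℕ → ℝ) (ε : ℕ → Ω → ℝ) {n s : ℕ} (hn : n ≤ s) :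
    Measurable[signSigma ε (Set.Iio s)] (rademacherWalk a ε n) := by
  rw [show rademacherWalk a ε n = fun ω => ∑ i ∈ Finset.range n, ε (i + 1) ω * a (i + 1) from
    funext (rademacherWalk_eq_sum_range a ε n)]
  refine Finset.measurable_fun_sum _ fun i hi => Measurable.mul_const (measurable_sign ε ?_) _
  exact (Finset.mem_range.1 hi).trans_le hn

/-- Signs are indexed from zero in `stride`, so `blockTime k` is the index of the block's first
sign, whose step is `2 ^ k + 1`. -/
lemma blockWalk_blockTime_add {Ω : Type*} (ε : ℕ → Ω → ℝ) (ω : Ω) {k m : ℕ} (hk : 1 ≤ k)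
    (hm : 2 * m ≤ 4 ^ k / 2) :
    blockWalk ε (blockTime k + 2 * m) ω = blockWalk ε (blockTime k) ω +
      (2 ^ k + 1) * signSum ε (stride (blockTime k) 0 m) ω +
      (2 ^ k - 1) * signSum ε (stride (blockTime k + 1) 0 m) ω := by
  simp only [signSum_stride, ← Finset.range_eq_Ico]
  induction m with
  | zero => simp
  | succ m ih =>
    have ih := ih (by omega)
    rw [blockWalk] at ih
    have hb : blockTime k + 1 = blockStart k := by
      have := six_mul_blockStart hk
      rw [blockTime]; omega
    have h1 : blockStep (blockTime k + 2 * m + 1) = 2 ^ k + 1 := by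
      rw [show blockTime k + 2 * m + 1 = blockStart k + 2 * m by omega,
        blockStep_blockStart_add hk (by omega), if_pos (even_two_mul m)]
    have h2 : blockStep (blockTime k + 2 * m + 1 + 1) = 2 ^ k - 1 := by
      rw [show blockTime k + 2 * m + 1 + 1 = blockStart k + (2 * m + 1) by omega,
        blockStep_blockStart_add hk (by omega), if_neg (by simp)]
    rw [Finset.sum_range_succ, Finset.sum_range_succ,
      show blockTime k + 2 * (m + 1) = blockTime k + 2 * m + 1 + 1 by ring, blockWalk,
      rademacherWalk_succ, rademacherWalk_succ, ih, h1, h2,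
      show blockTime k + 1 + 2 * m + 1 = blockTime k + 2 * m + 1 + 1 by ring]
    push_cast
    ring

lemma exists_blockWalk_eq {Ω : Type*} (ε : ℕ → Ω → ℝ) {ω : Ω}
    (hω : ∀ i, ε (i + 1) ω = 1 ∨ ε (i + 1) ω = -1) (n : ℕ) :
    ∃ z : ℤ, blockWalk ε n ω = 2 * z + n := by
  induction n with
  | zero => exact ⟨0, by simp [rademacherWalk]⟩
  | succ n ih =>
    obtain ⟨z, hz⟩ := ih
    obtain ⟨c, hc⟩ := odd_blockStep (show 1 ≤ n + 1 by omega)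
    rw [blockWalk] at hz
    rcases hω n with h | h
    · refine ⟨z + c, ?_⟩
      rw [blockWalk, rademacherWalk_succ, hz, h, hc]
      push_cast; ring
    · refine ⟨z - c - 1, ?_⟩
      rw [blockWalk, rademacherWalk_succ, hz, h, hc]
      push_cast; ring

/-- All steps are odd, so the walk has the parity of the time, and `blockTime k` is even. -/
lemma exists_blockWalk_blockTime_eq {Ω : Type*} (ε : ℕ → Ω → ℝ) {ω : Ω}
    (hω : ∀ i, ε (i + 1) ω = 1 ∨ ε (i + 1) ω = -1) {k : ℕ} (hk : 1 ≤ k) :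
    ∃ z : ℤ, blockWalk ε (blockTime k) ω = 2 * z := by
  obtain ⟨z, hz⟩ := exists_blockWalk_eq ε hω (blockTime k)
  have h := six_mul_blockTime hk
  obtain ⟨j, rfl⟩ := Nat.exists_eq_add_of_le' hk
  rw [pow_succ] at h
  obtain ⟨q, hq⟩ : ∃ q, blockTime (j + 1) = 2 * q := ⟨blockTime (j + 1) / 2, by omega⟩
  refine ⟨z + q, ?_⟩
  rw [hz, hq]
  push_cast; ring

/-! ### Variance of the walk. -/

namespace IsRademacherSequence

variable {Ω : Type*} [MeasurableSpace Ω] {μ : Measure Ω} [IsProbabilityMeasure μ]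
  {ε : ℕ → Ω → ℝ}

lemma memLp_sign (h : IsRademacherSequence μ ε) (i : ℕ) (p : ENNReal) :
    MemLp (ε (i + 1)) p μ := by
  refine MemLp.of_bound (h.measurable _ (by omega)).aestronglyMeasurable 1 ?_
  filter_upwards [h.ae_eq_one_or] with ω hω
  rcases hω i with h1 | h1 <;> simp [h1]

lemma integral_sign (h : IsRademacherSequence μ ε) (i : ℕ) : ∫ ω, ε (i + 1) ω ∂μ = 0 := by
  have hm := h.measurable (i + 1) (by omega)
  have m1 : MeasurableSet {ω | ε (i + 1) ω = 1} := hm (measurableSet_singleton 1)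
  have m2 : MeasurableSet {ω | ε (i + 1) ω = -1} := hm (measurableSet_singleton (-1))
  have hae : ε (i + 1) =ᵐ[μ] fun ω => {ω | ε (i + 1) ω = 1}.indicator (1 : Ω → ℝ) ω -
      {ω | ε (i + 1) ω = -1}.indicator (1 : Ω → ℝ) ω := by
    filter_upwards [h.ae_eq_one_or] with ω hω
    rcases hω i with h1 | h1 <;> simp [Set.indicator, h1] <;> norm_num
  have i1 : Integrable ({ω | ε (i + 1) ω = 1}.indicator (1 : Ω → ℝ)) μ :=
    (integrable_const (1 : ℝ)).indicator m1
  have i2 : Integrable ({ω | ε (i + 1) ω = -1}.indicator (1 : Ω → ℝ)) μ :=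
    (integrable_const (1 : ℝ)).indicator m2
  rw [integral_congr_ae hae, integral_sub i1 i2, integral_indicator_one m1,
    integral_indicator_one m2, Measure.real, Measure.real, h.prob_eq_one _ (by omega),
    h.prob_eq_neg_one _ (by omega), sub_self]

lemma integral_rademacherWalk (h : IsRademacherSequence μ ε) (a : ℕ → ℝ) (n : ℕ) :
    ∫ ω, rademacherWalk a ε n ω ∂μ = 0 := by
  simp_rw [rademacherWalk_eq_sum_range]
  rw [integral_finsetSum _ fun i _ => ((h.memLp_sign i 1).integrable le_rfl).mul_const _]
  refine Finset.sum_eq_zero fun i _ => ?_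
  rw [integral_mul_const, h.integral_sign, zero_mul]

lemma memLp_rademacherWalk (h : IsRademacherSequence μ ε) (a : ℕ → ℝ) (n : ℕ) :
    MemLp (rademacherWalk a ε n) 2 μ := by
  rw [show rademacherWalk a ε n = fun ω => ∑ i ∈ Finset.range n, ε (i + 1) ω * a (i + 1) from
    funext (rademacherWalk_eq_sum_range a ε n)]
  exact memLp_finsetSum _ fun i _ => (h.memLp_sign i 2).mul_const _

lemma variance_rademacherWalk_le (h : IsRademacherSequence μ ε) (a : ℕ → ℝ) (n : ℕ) :
    variance (rademacherWalk a ε n) μ ≤ ∑ i ∈ Finset.range n, a (i + 1) ^ 2 := by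
  rw [show rademacherWalk a ε n = ∑ i ∈ Finset.range n, fun ω => ε (i + 1) ω * a (i + 1) by
    ext ω; rw [rademacherWalk_eq_sum_range, Finset.sum_apply]]
  rw [IndepFun.variance_sum (fun i _ => (h.memLp_sign i 2).mul_const _)]
  · refine Finset.sum_le_sum fun i _ => ?_
    refine (variance_le_expectation_sq
      ((h.memLp_sign i 2).mul_const _).aestronglyMeasurable).trans (le_of_eq ?_)
    have hae : (fun ω => (ε (i + 1) ω * a (i + 1)) ^ 2) =ᵐ[μ] fun _ => a (i + 1) ^ 2 := by
      filter_upwards [h.ae_eq_one_or] with ω hω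
      rcases hω i with h1 | h1 <;> simp [h1]
    exact (integral_congr_ae hae).trans (by simp)
  · intro i _ j _ hij
    exact (h.indep.indepFun hij).comp (measurable_id.mul_const (a (i + 1)))
      (measurable_id.mul_const (a (j + 1)))

/-- Chebyshev: fewer than `4 ^ k` steps precede block `k`, each of size at most `2 ^ k`, so the
variance is at most `(4 ^ k) ^ 2`. -/
lemma measureReal_lt_abs_blockWalk_le (h : IsRademacherSequence μ ε) {k C : ℕ} (hk : 1 ≤ k)
    (hC : 1 ≤ C) :
    μ.real {ω | (C * 4 ^ k : ℝ) < |blockWalk ε (blockTime k) ω|} ≤ 1 / C ^ 2 := by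
  have hC0 : (0 : ℝ) < C := by exact_mod_cast hC
  have hc : (0 : ℝ) < C * 4 ^ k := by positivity
  have hv : variance (blockWalk ε (blockTime k)) μ ≤ (4 ^ k) ^ 2 := by
    refine (h.variance_rademacherWalk_le _ _).trans ?_
    have h1 : ∀ i ∈ Finset.range (blockTime k), ((blockStep (i + 1) : ℝ)) ^ 2 ≤ 4 ^ k := by
      intro i hi
      have h2 : blockStep (i + 1) ≤ 2 ^ k := blockStep_le_two_pow hk (by
        have := Finset.mem_range.1 hi
        rw [blockTime] at this
        omega)
      have h3 : ((blockStep (i + 1) : ℝ)) ≤ 2 ^ k := by exact_mod_cast h2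
      have h4 : (0 : ℝ) ≤ blockStep (i + 1) := by exact_mod_cast blockStep_nonneg _
      calc ((blockStep (i + 1) : ℝ)) ^ 2 ≤ ((2 : ℝ) ^ k) ^ 2 := by gcongr
        _ = 4 ^ k := by rw [← pow_mul, mul_comm, pow_mul]; norm_num
    refine (Finset.sum_le_card_nsmul _ _ _ h1).trans ?_
    rw [Finset.card_range, nsmul_eq_mul, sq]
    gcongr
    have := six_mul_blockTime hk
    exact_mod_cast (show blockTime k ≤ 4 ^ k by omega)
  have hch := meas_ge_le_variance_div_sq 
    (h.memLp_rademacherWalk (fun n => (blockStep n : ℝ)) (blockTime k)) hc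
  rw [h.integral_rademacherWalk] at hch
  simp only [sub_zero] at hch
  have hle : μ {ω | (C * 4 ^ k : ℝ) < |blockWalk ε (blockTime k) ω|} ≤
      ENNReal.ofReal (1 / C ^ 2) := by
    refine (measure_mono fun ω hω => ?_).trans (hch.trans (ENNReal.ofReal_le_ofReal ?_))
    · exact le_of_lt (show (C * 4 ^ k : ℝ) < |blockWalk ε (blockTime k) ω| from hω)
    · rw [div_le_div_iff₀ (by positivity) (by positivity), one_mul, mul_pow, mul_comm]
      gcongr
  exact ENNReal.toReal_le_of_le_ofReal (by positivity) hle

end IsRademacherSequence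

/-! ### Visits within a block, and recurrence. -/

namespace IsRademacherSequence

variable {Ω : Type*} [MeasurableSpace Ω] {μ : Measure Ω} [IsProbabilityMeasure μ]
  {ε : ℕ → Ω → ℝ}

/-- Whatever the past, as long as the walk is at distance `O(4 ^ k)` at the start of the `k`-th
block, it visits a given even integer during that block with probability of order at least
`1 / k`. -/
lemma exists_div_le_measureReal_inter_visit (h : IsRademacherSequence μ ε) {m : ℤ} (hm : Even m)
    {C : ℕ} (hC : 1 ≤ C) :
    ∃ c : ℝ, 0 < c ∧ ∃ k₀ : ℕ, ∀ k, k₀ ≤ k → ∀ E : Set Ω,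
      MeasurableSet[signSigma ε (Set.Iio (blockTime k))] E →
      E ⊆ {ω | |blockWalk ε (blockTime k) ω| ≤ C * 4 ^ k} →
      c / k * μ.real E ≤ μ.real (E ∩ {ω | ∃ n, blockTime k ≤ n ∧ n ≤ blockTime (k + 1) ∧
        blockWalk ε n ω = m}) := by
  obtain ⟨m', rfl⟩ := hm.two_dvd
  obtain ⟨A, hA⟩ : ∃ A, A = 4 * (C + 2) := ⟨_, rfl⟩
  -- The threshold on `k` ensures `4 * A ≤ r` and `|m'| ≤ r` for `r = 2 ^ (k - 2)`, because `l < 2 ^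
  -- l`.
  refine ⟨Real.exp (-(8 * (A : ℝ) ^ 2)) / 48, by positivity, 4 * A + 2 + m'.natAbs, ?_⟩
  intro k hk E hE hEC
  have hk1 : 1 ≤ k := by omega
  obtain ⟨l, hkl⟩ : ∃ l, k = l + 2 := ⟨k - 2, by omega⟩
  -- With this `r`, the `4 n ≤ 8 r ^ 2` steps used by the two walks fit exactly into the block, of
  -- length `4 ^ k / 2 = 8 r ^ 2`.
  obtain ⟨r, hr⟩ : ∃ r, r = 2 ^ l := ⟨_, rfl⟩
  have hr1 : 1 ≤ r := hr ▸ Nat.one_le_two_pow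
  have hlr : l < r := hr ▸ Nat.lt_two_pow_self
  have hAr : 4 * A ≤ r := by omega
  have h4r : 4 ^ k = 16 * r ^ 2 := by
    rw [hkl, hr, ← pow_mul, mul_comm l 2, pow_mul, pow_add]; norm_num [mul_comm]
  have hw : (2 : ℤ) ^ k = 4 * r := by
    rw [hkl, hr, pow_add]; push_cast; ring
  have hwR : (2 : ℝ) ^ k = 4 * r := by exact_mod_cast hw
  have hmk : (m'.natAbs : ℤ) ≤ 8 * (r : ℤ) ^ 2 := by
    have : m'.natAbs ≤ r := by omega
    have : m'.natAbs ≤ 8 * r ^ 2 := by nlinarith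
    exact_mod_cast this
  set V : Set Ω := {ω | ∃ n, blockTime k ≤ n ∧ n ≤ blockTime (k + 1) ∧
    blockWalk ε n ω = (2 * m' : ℤ)} with hV
  obtain ⟨Z, hZ⟩ : ∃ Z : Finset ℤ, Z = Finset.Icc (-(8 * C * r ^ 2) : ℤ) (8 * C * r ^ 2) := ⟨_, rfl⟩
  have htarget : ∀ z ∈ Z, ∃ a b : ℤ, (4 * (r : ℤ) + 1) * a + (4 * r - 1) * b = m' - z ∧
      a.natAbs ≤ A * r ∧ b.natAbs ≤ A * r := by
    intro z hz
    rw [hZ, Finset.mem_Icc] at hz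
    have hm2 := abs_le.1 ((Int.abs_eq_natAbs m').le.trans hmk)
    have hC' : (1 : ℤ) ≤ C := by exact_mod_cast hC
    -- Here `|m' - z| ≤ 8 r ^ 2 + 8 C r ^ 2 ≤ C w ^ 2`, as `w = 4 r` and `C ≥ 1`.
    obtain ⟨a, b, hab, ha, hb⟩ := exists_repr (w := 4 * (r : ℤ)) (y := m' - z) (L := C)
      (by omega) ⟨2 * r, by ring⟩
      (abs_le.2 ⟨by nlinarith [sq_nonneg (r : ℤ)], by nlinarith [sq_nonneg (r : ℤ)]⟩)
    refine ⟨a, b, hab, ?_, ?_⟩ <;> zify <;> rw [hA] <;> push_cast <;> linarith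
  choose! a b hab ha hb using htarget
  -- `E` is split by the starting position `2 z`: `F z` depends on signs before the block, `U z` on
  -- later ones, hence they are independent.
  set F : ℤ → Set Ω := fun z => E ∩ {ω | blockWalk ε (blockTime k) ω = 2 * z} with hF
  set U : ℤ → Set Ω := fun z => ⋃ n ∈ Finset.Ioc (r ^ 2) (2 * r ^ 2),
    pairEvent ε (blockTime k) 0 n (a z) (b z) with hU
  have hFm : ∀ z, MeasurableSet[signSigma ε (Set.Iio (blockTime k))] (F z) := fun z =>
    hE.inter (measurable_rademacherWalk _ ε le_rfl (measurableSet_singleton _))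
  have hUm : ∀ z, MeasurableSet[signSigma ε (Set.Ici (blockTime k))] (U z) := fun z =>
    Finset.measurableSet_biUnion _ fun n _ =>
      signSigma_mono ε (fun i hi => hi.1) _
        (measurableSet_pairEvent ε (blockTime k) 0 n (a z) (b z))
  have hprod : ∀ z, μ.real (F z ∩ U z) = μ.real (F z) * μ.real (U z) := fun z =>
    h.measureReal_inter (Set.Iio_disjoint_Ici le_rfl) (hFm z) (hUm z)
  have hsub : ∀ z ∈ Z, F z ∩ U z ⊆ E ∩ V := by
    rintro z hz ω ⟨⟨hωE, hωz⟩, hωU⟩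
    obtain ⟨n, hn, hωn⟩ := Set.mem_iUnion₂.1 hωU
    rw [Finset.mem_Ioc] at hn
    have hlen : 2 * (2 * n) ≤ 4 ^ k / 2 := by omega
    refine ⟨hωE, blockTime k + 2 * (2 * n), by omega, by rw [blockTime_succ hk1]; omega, ?_⟩
    have h1 : signSum ε (stride (blockTime k) 0 (2 * n)) ω = 2 * a z := hωn.1
    have h2 : signSum ε (stride (blockTime k + 1) 0 (2 * n)) ω = 2 * b z := hωn.2
    have h3 : blockWalk ε (blockTime k) ω = 2 * z := hωz
    have h4 : ((4 * (r : ℝ) + 1) * a z + (4 * r - 1) * b z) = m' - z := by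
      exact_mod_cast hab z hz
    rw [blockWalk_blockTime_add ε ω hk1 hlen, h1, h2, h3, hwR]
    push_cast
    linarith
  have hdisj : (Z : Set ℤ).PairwiseDisjoint fun z => F z ∩ U z := by
    intro x _ y _ hxy
    refine Set.disjoint_left.2 ?_
    rintro ω ⟨⟨-, hx⟩, -⟩ ⟨⟨-, hy⟩, -⟩
    have hx' : blockWalk ε (blockTime k) ω = 2 * x := hx
    have hy' : blockWalk ε (blockTime k) ω = 2 * y := hy
    exact hxy (by exact_mod_cast (show (x : ℝ) = y by linarith))
  have hcover : μ.real E ≤ ∑ z ∈ Z, μ.real (F z) := by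
    refine le_trans ?_ (measureReal_biUnion_finset_le Z F)
    refine ENNReal.toReal_mono (measure_ne_top _ _) (measure_mono_ae ?_)
    filter_upwards [h.ae_eq_one_or] with ω hω hωE
    obtain ⟨z, hz⟩ := exists_blockWalk_blockTime_eq ε hω hk1
    have hb : |blockWalk ε (blockTime k) ω| ≤ C * 4 ^ k := hEC hωE
    rw [hz, abs_le, show (4 : ℝ) ^ k = 16 * r ^ 2 by exact_mod_cast h4r] at hb
    refine Set.mem_iUnion₂.2 ⟨z, ?_, hωE, hz⟩
    rw [hZ, Finset.mem_Icc]
    constructor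
    · have : (-(8 * C * r ^ 2) : ℝ) ≤ z := by linarith
      exact_mod_cast this
    · have : (z : ℝ) ≤ 8 * C * r ^ 2 := by linarith
      exact_mod_cast this
  calc _ ≤ Real.exp (-(8 * (A : ℝ) ^ 2)) / 48 / k * ∑ z ∈ Z, μ.real (F z) := by gcongr
    _ = ∑ z ∈ Z, μ.real (F z) * (Real.exp (-(8 * (A : ℝ) ^ 2)) / 48 / k) := by
      rw [mul_comm, Finset.sum_mul]
    _ ≤ ∑ z ∈ Z, μ.real (F z ∩ U z) := by
      refine Finset.sum_le_sum fun z hz => ?_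
      rw [hprod]
      exact mul_le_mul_of_nonneg_left (h.exp_div_le_measureReal_biUnion_pairEvent (blockTime k)
        hr1 hAr (ha z hz) (hb z hz) hk1 (by omega)) measureReal_nonneg
    _ = μ.real (⋃ z ∈ Z, F z ∩ U z) :=
      (measureReal_biUnion_finset hdisj fun z _ =>
        (h.signSigma_le _ _ (hFm z)).inter (h.signSigma_le _ _ (hUm z))).symm
    _ ≤ _ := measureReal_mono (Set.iUnion₂_subset hsub)

/-- Almost surely the walk visits a given even integer after the start of the `K`-th block. -/
lemma measureReal_avoid_eq_zero (h : IsRademacherSequence μ ε) {m : ℤ} (hm : Even m) {K : ℕ}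
    (hK : 1 ≤ K) : μ.real {ω | ∀ n, blockTime K ≤ n → blockWalk ε n ω ≠ m} = 0 := by
  set D : Set Ω := {ω | ∀ n, blockTime K ≤ n → blockWalk ε n ω ≠ m} with hD
  set N : ℕ → Set Ω := fun k =>
    {ω | ∀ n, blockTime K ≤ n → n ≤ blockTime k → blockWalk ε n ω ≠ m} with hN
  have hNm : ∀ k, MeasurableSet[signSigma ε (Set.Iio (blockTime k))] (N k) := by
    intro k
    have : N k = ⋂ n, ⋂ (_ : blockTime K ≤ n), ⋂ (_ : n ≤ blockTime k),
        (blockWalk ε n ⁻¹' {(m : ℝ)})ᶜ := by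
      ext ω
      simp [hN]
    rw [this]
    exact MeasurableSet.iInter fun n => MeasurableSet.iInter fun _ => MeasurableSet.iInter
      fun hn => (measurable_rademacherWalk _ ε hn (measurableSet_singleton _)).compl
  have key : ∀ C : ℕ, 1 ≤ C → μ.real D ≤ 1 / C ^ 2 := by
    intro C hC
    by_contra! hlt
    obtain ⟨c, hc, k₀, hstep⟩ := h.exists_div_le_measureReal_inter_visit hm hC
    set δ := μ.real D - 1 / C ^ 2 with hδ
    have hδ0 : 0 < δ := by linarith
    set k₁ := k₀ + K with hk₁
    -- If the claimed bound failed, at least mass `δ` would have avoided `m` so far and be within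
    -- range at each block start; a fraction `c / k` of it hits `m` during the block.
    have hdrop : ∀ k, k₁ ≤ k → c * δ * (1 / k) ≤ μ.real (N k) - μ.real (N (k + 1)) := by
      intro k hk
      have hk1 : 1 ≤ k := by omega
      set B : Set Ω := {ω | |blockWalk ε (blockTime k) ω| ≤ C * 4 ^ k} with hB
      have hBm : MeasurableSet[signSigma ε (Set.Iio (blockTime k))] B :=
        measurableSet_Iic.preimage (measurable_norm.comp (measurable_rademacherWalk _ ε le_rfl))
      have h1 := hstep k (by omega) (N k ∩ B) ((hNm k).inter hBm) Set.inter_subset_right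
      have h2 : δ ≤ μ.real (N k ∩ B) := by
        have h3 : D ⊆ (N k ∩ B) ∪ {ω | (C * 4 ^ k : ℝ) < |blockWalk ε (blockTime k) ω|} := by
          intro ω hω
          by_cases hb : ω ∈ B
          · exact Or.inl ⟨fun n hn _ => hω n hn, hb⟩
          · exact Or.inr (show (C * 4 ^ k : ℝ) < _ from lt_of_not_ge hb)
        have h4 := (measureReal_mono (μ := μ) h3).trans (measureReal_union_le _ _)
        have h5 := h.measureReal_lt_abs_blockWalk_le hk1 hC
        linarith
      have hsub : N (k + 1) ⊆ N k := fun ω hω n hn hn' =>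
        hω n hn (hn'.trans (blockTime_mono hk1 (Nat.le_succ k)))
      rw [← measureReal_sdiff hsub (h.signSigma_le _ _ (hNm (k + 1)))]
      calc c * δ * (1 / k) = c / k * δ := by ring
        _ ≤ c / k * μ.real (N k ∩ B) := by gcongr
        _ ≤ _ := h1
        _ ≤ _ := by
          refine measureReal_mono ?_
          rintro ω ⟨⟨hωN, -⟩, n, hn1, hn2, hn3⟩
          exact ⟨hωN, fun hω =>
            hω n ((blockTime_mono hK (by omega)).trans hn1) hn2 hn3⟩
    have hsum : ∀ j, c * δ * ∑ i ∈ Finset.range j, (1 : ℝ) / ((i + k₁ : ℕ) : ℝ) ≤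
        μ.real (N k₁) - μ.real (N (j + k₁)) := by
      intro j
      induction j with
      | zero => simp
      | succ j ih =>
        have := hdrop (j + k₁) (by omega)
        rw [Finset.sum_range_succ, mul_add, show j + 1 + k₁ = j + k₁ + 1 by ring]
        linarith
    -- The drops telescope to at most `1`, which would make the harmonic series converge.
    refine Real.not_summable_one_div_natCast ((summable_nat_add_iff k₁).1 ?_)
    refine summable_of_sum_range_le (c := 1 / (c * δ)) (fun i => by positivity) fun j => ?_
    rw [le_div_iff₀' (by positivity)]
    have h6 : μ.real (N k₁) ≤ 1 := measureReal_le_one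
    have h7 : 0 ≤ μ.real (N (j + k₁)) := measureReal_nonneg
    linarith [hsum j]
  refine le_antisymm (le_of_forall_pos_le_add fun η hη => ?_) measureReal_nonneg
  obtain ⟨C, hC⟩ := exists_nat_one_div_lt hη
  refine (key (C + 1) (by omega)).trans ?_
  have h1 : (1 : ℝ) ≤ C + 1 := by linarith [(Nat.cast_nonneg C : (0 : ℝ) ≤ C)]
  have h2 : (1 : ℝ) / ((C + 1 : ℕ) : ℝ) ^ 2 ≤ 1 / (C + 1) := by
    push_cast
    exact div_le_div_of_nonneg_left zero_le_one (by linarith) (by nlinarith)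
  linarith

lemma ae_frequently_blockWalk_eq (h : IsRademacherSequence μ ε) :
    ∀ᵐ ω ∂μ, ∀ m : ℤ, Even m → ∃ᶠ n in atTop, blockWalk ε n ω = m := by
  rw [ae_all_iff]
  intro m
  by_cases hm : Even m
  swap
  · exact ae_of_all _ fun ω hm' => absurd hm' hm
  -- The shift by `2` keeps the block number positive and makes `blockTime (M + 2) ≥ M`, so the
  -- visits found occur arbitrarily late.
  have hK : ∀ᵐ ω ∂μ, ∀ K : ℕ, ¬ ∀ n, blockTime (K + 2) ≤ n → blockWalk ε n ω ≠ m := by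
    rw [ae_all_iff]
    intro K
    have h0 := h.measureReal_avoid_eq_zero hm (show 1 ≤ K + 2 by omega)
    rw [measureReal_eq_zero_iff] at h0
    rw [ae_iff]
    simpa using h0
  filter_upwards [hK] with ω hω _
  rw [frequently_atTop]
  intro M
  obtain ⟨n, hn⟩ := not_forall.1 (hω M)
  simp only [ne_eq, Classical.not_imp, not_not] at hn
  refine ⟨n, le_trans ?_ hn.1, hn.2⟩
  have h1 := six_mul_blockTime (show 1 ≤ M + 2 by omega)
  have h2 : M < 4 ^ M := Nat.lt_pow_self (by norm_num)
  rw [pow_add] at h1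
  omega

end IsRademacherSequence

theorem theorem1p2 :
    ∃ a : ℕ → ℤ,
      (∀ n, 1 ≤ n → 0 ≤ a n) ∧
      (∀ k : ℕ, 1 ≤ k → ∀ j : ℕ, j < 4 ^ k / 2 →
        a (blockStart k + j) = if Even j then 2 ^ k + 1 else 2 ^ k - 1) ∧
      (fun n : ℕ => (a n : ℝ)) =Θ[atTop] (fun n : ℕ => (n : ℝ) ^ (1 / 2 : ℝ)) ∧
      ∀ (Ω : Type*) [MeasurableSpace Ω] (μ : Measure Ω) [IsProbabilityMeasure μ]
        (ε : ℕ → Ω → ℝ), IsRademacherSequence μ ε →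
        WeaklyRecurrent μ (rademacherWalk (fun n => (a n : ℝ)) ε) ∧
        ∀ᵐ ω ∂μ, ∀ m : ℤ, Even m →
          ∃ᶠ n in atTop, rademacherWalk (fun n => (a n : ℝ)) ε n ω = (m : ℝ) := by
  refine ⟨blockStep, fun n _ => blockStep_nonneg n, fun k hk j hj => blockStep_blockStart_add hk hj,
    blockStep_isTheta, fun Ω _ μ _ ε h => ⟨?_, h.ae_frequently_blockWalk_eq⟩⟩
  filter_upwards [h.ae_frequently_blockWalk_eq] with ω hω
  refine ⟨0, (hω 0 Even.zero).mono fun n hn => ?_⟩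
  have hn' : rademacherWalk (fun n => (blockStep n : ℝ)) ε n ω = ((0 : ℤ) : ℝ) := hn
  simp [hn']
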